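/- For $|k|<1$ let $\mathbf K(k)=\int_0^1\frac{du}{\sqrt{(1-u^2)(1-k^2u^2)}}$ be the complete elliptic integral of the first kind with modulus $k$, and for $a>b>0$ put $$\mathbf K_{+}=\mathbf K\!\left(\frac{\sqrt a+\sqrt b}{\sqrt{2(a+b)}}\right),\qquad \mathbf K_{-}=\mathbf K\!\left(\frac{\sqrt a-\sqrt b}{\sqrt{2(a+b)}}\right).$$ Let $\mathrm F_D^{(n)}(\alpha;\beta;\gamma\mid x_1,\dots,x_n)$ denote the Lauricella function with all $n$ parameters of type $\beta$ equal, that is, the holomorphic continuation to $(\mathbb C\setminus[1,\infty))^n$ of the series $$\sum_{m_1,\dots,m_n\ge 0}\frac{(\alpha)_{m_1+\cdots+m_n}(\beta)_{m_1}\cdots(\beta)_{m_n}}{(\gamma)_{m_1+\cdots+m_n}\,m_1!\cdots m_n!}\,x_1^{m_1}\cdots x_n^{m_n}\qquad(|x_1|<1,\dots,|x_n|<1),$$ where $(\lambda)_m=\lambda(\lambda+1)\cdots(\lambda+m-1)$ and $i=\sqrt{-1}$. Then for all real numbers $a>b>0$ the following six formulae hold: $$\pi=\frac{4}{\sqrt{ab(a+b)}}\,\frac{\mathbf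 K_{-}}{\mathrm F_D^{(4)}\left(\tfrac32;\tfrac12;2\mid 1+ia,1-ia,1+ib,1-ib\right)},$$ $$\pi=\frac{4}{\sqrt{a+b}}\,\frac{\mathbf K_{-}}{\mathrm F_D^{(4)}\left(\tfrac12;\tfrac12;2\mid 1+ia,1-ia,1+ib,1-ib\right)},$$ $$\pi=\frac{2\sqrt{a-b}}{\sqrt b}\,\frac{\mathbf K_{+}-\mathbf K_{-}}{\mathrm F_D^{(3)}\left(\tfrac12;\tfrac12;2\mid \tfrac12,\tfrac{b}{a+b},\tfrac{b}{b-a}\right)},$$ $$\pi=\frac{\sqrt{a-b}}{\sqrt a}\,\frac{\mathbf K_{+}+\mathbf K_{-}}{\mathrm F_D^{(3)}\left(\tfrac12;\tfrac12;1\mid \tfrac12,\tfrac{b}{a+b},\tfrac{b}{b-a}\right)},$$ $$\pi=\frac{\sqrt a}{\sqrt{2(a+b)}}\,\frac{\mathbf K_{+}+\mathbf K_{-}}{\mathrm F_D^{(3)}\left(\tfrac12;\tfrac12;1\mid -1,\tfrac ba,-\tfrac ba\right)},$$ $$\pi=\frac{\sqrt2\,a}{\sqrt{b(a+b)}}\,\frac{\mathbf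 K_{+}-\mathbf K_{-}}{\mathrm F_D^{(3)}\left(\tfrac32;\tfrac12;2\mid -1,\tfrac ba,-\tfrac ba\right)}.$$ -/

import Mathlib

/-- The complete elliptic integral of the first kind as a function of the modulus `k`
(to be used for `|k| < 1`): `K(k) = ∫₀¹ du / √((1 - u²)(1 - k²u²))`. -/
noncomputable def ellipticK (k : ℝ) : ℝ :=
  ∫ u in (0 : ℝ)..1, 1 / Real.sqrt ((1 - u ^ 2) * (1 - k ^ 2 * u ^ 2))

/-- `K₊^{(a,b)} = K((√a + √b) / √(2(a+b)))`. -/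
noncomputable def ellipticKPlus (a b : ℝ) : ℝ :=
  ellipticK ((Real.sqrt a + Real.sqrt b) / Real.sqrt (2 * (a + b)))

/-- `K₋^{(a,b)} = K((√a - √b) / √(2(a+b)))`. -/
noncomputable def ellipticKMinus (a b : ℝ) : ℝ :=
  ellipticK ((Real.sqrt a - Real.sqrt b) / Real.sqrt (2 * (a + b)))

/-- The Pochhammer symbol `(z)_m = z (z+1) ⋯ (z+m-1)`. -/
noncomputable def pochhammerSymbol (z : ℂ) (m : ℕ) : ℂ :=
  (ascPochhammer ℂ m).eval z

/-- The term of multi-index `m` in the Lauricella series `F_D^{(n)}(a; b₁, …, bₙ; c | x₁, …, xₙ)`. -/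
noncomputable def lauricellaTerm {n : ℕ} (a : ℂ) (b : Fin n → ℂ) (c : ℂ) (x : Fin n → ℂ)
    (m : Fin n → ℕ) : ℂ :=
  pochhammerSymbol a (∑ i, m i) * (∏ i, pochhammerSymbol (b i) (m i)) /
    (pochhammerSymbol c (∑ i, m i) * ∏ i, ((m i).factorial : ℂ)) * ∏ i, x i ^ m i

/-- The Lauricella series, summed over all multi-indices; it converges absolutely on the unit
polydisc `|x₁| < 1, …, |xₙ| < 1` (for `c` not a non-positive integer). -/
noncomputable def lauricellaSeries {n : ℕ} (a : ℂ) (b : Fin n → ℂ) (c : ℂ) (x : Fin n → ℂ) : ℂ :=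
  ∑' m : Fin n → ℕ, lauricellaTerm a b c x m

/-- The domain of the principal branch of `F_D^{(n)}`: the points of `ℂⁿ` none of whose coordinates
lies on the real half-line `[1, ∞)`. It is open, star-shaped about `0`, and contains the unit
polydisc. -/
def lauricellaDomain (n : ℕ) : Set (Fin n → ℂ) :=
  {x | ∀ i, 1 - x i ∈ Complex.slitPlane}

/-- `F` is an analytic continuation of the Lauricella series to the cut domain: it is holomorphic
there and coincides with the sum of the series on the unit polydisc. By the identity theorem this
determines `F` on `lauricellaDomain n`. -/
def IsLauricellaContinuation {n : ℕ} (a : ℂ) (b : Fin n → ℂ) (c : ℂ)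
    (F : (Fin n → ℂ) → ℂ) : Prop :=
  DifferentiableOn ℂ F (lauricellaDomain n) ∧
    ∀ x : Fin n → ℂ, (∀ i, ‖x i‖ < 1) → F x = lauricellaSeries a b c x

open Classical in
/-- The Lauricella function `F_D^{(n)}(a; b₁, …, bₙ; c | x₁, …, xₙ)`: the value at `x` of the
analytic continuation of the Lauricella series to the cut domain (and `0` by convention at points
outside that domain, or if there is no such continuation). -/
noncomputable def lauricellaFD {n : ℕ} (a : ℂ) (b : Fin n → ℂ) (c : ℂ) (x : Fin n → ℂ) : ℂ :=
  if h : x ∈ lauricellaDomain n ∧ ∃ F : (Fin n → ℂ) → ℂ, IsLauricellaContinuation a b c F then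
    h.2.choose x
  else 0

open MeasureTheory Set Filter Topology

/-! Euler's integral B(α, γ-α) F_D = ∫₀¹ t^(α-1) (1-t)^(γ-α-1) ∏ (1 - t x_i)^(-β_i) dt, valid on the
whole cut domain (`betaIntegral_mul_lauricellaFD`), turns each formula into the evaluation of a real
integral. The Beta factor is π or π/2, which is where π comes from.

At 1 ± ia, 1 ± ib the conjugate factors multiply to ((1-t)² + a²t²)((1-t)² + b²t²). With w =
√((1-t)/t), c = √(ab) and v = w - c/w, the sum of the α = 1/2 integral and c times the α = 3/2
integral becomes an integral of 1/√(biquadratic in v), a multiple of K₋ (`integral_quartic_eq`,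
`integral_one_div_sqrt_biquadratic`). The involution w ↦ c/w shows that the two summands are equal
(`integral_quartic_reflect`).

At -1, ±b/a the integrals are those of dt/y and t dt/y on the genus two curve y² = t(1-t²)(1-κ²t²),
κ = b/a. The involution t ↦ 1/(κt) makes this curve cover two elliptic curves. Pulling back their
holomorphic differentials expresses K₊ and K₋ through (1 ± √κ t) dt/y (`ellipticK_eq_genusTwo`); sum
and difference isolate the two integrals. The points 1/2, b/(a+b), b/(b-a) reduce to this case by t
↦ 1-t, the Pfaff transformation x ↦ x/(x-1). -/

/-! ### Binomial series and their finite products -/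

theorem pochhammerSymbol_div_factorial (z : ℂ) (m : ℕ) :
    pochhammerSymbol z m / (m.factorial : ℂ) = Ring.choose (z + m - 1) m := by
  have h := Ring.factorial_nsmul_multichoose_eq_ascPochhammer z m
  rw [Polynomial.ascPochhammer_smeval_eq_eval, Ring.multichoose_eq, nsmul_eq_mul] at h
  rw [pochhammerSymbol, ← h, mul_div_cancel_left₀]
  exact_mod_cast m.factorial_ne_zero

theorem summable_norm_and_hasSum_one_sub_cpow (β : ℂ) {z : ℂ} (hz : ‖z‖ < 1) :
    Summable (fun m : ℕ ↦ ‖pochhammerSymbol β m / (m.factorial : ℂ) * z ^ m‖) ∧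
      HasSum (fun m : ℕ ↦ pochhammerSymbol β m / (m.factorial : ℂ) * z ^ m) ((1 - z) ^ (-β)) := by
  have h := Complex.one_div_one_sub_cpow_hasFPowerSeriesOnBall_zero β
  have hz' : z ∈ Metric.eball (0 : ℂ) 1 := by
    rw [← ENNReal.ofReal_one, Metric.eball_ofReal]; simpa using hz
  constructor
  · have := FormalMultilinearSeries.summable_norm_apply _ (Metric.eball_subset_eball h.r_le hz')
    refine this.congr fun m ↦ ?_
    rw [pochhammerSymbol_div_factorial]
    simp [FormalMultilinearSeries.ofScalars]
  · have := h.hasSum hz'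
    rw [zero_add, one_div, ← Complex.cpow_neg] at this
    refine this.congr_fun ?_
    intro m
    rw [pochhammerSymbol_div_factorial]
    simp [FormalMultilinearSeries.ofScalars]

/-- Induction splitting off coordinate 0. Absolute summability is carried along because multiplying
the two sums requires it. -/
theorem summable_norm_and_hasSum_prod_fin {n : ℕ} {f : Fin n → ℕ → ℂ} {s : Fin n → ℂ}
    (hf : ∀ i, Summable fun k ↦ ‖f i k‖) (hs : ∀ i, HasSum (f i) (s i)) :
    Summable (fun m : Fin n → ℕ ↦ ‖∏ i, f i (m i)‖) ∧
      HasSum (fun m : Fin n → ℕ ↦ ∏ i, f i (m i)) (∏ i, s i) := by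
  induction n with
  | zero =>
    constructor
    · exact (hasSum_fintype _).summable
    · simpa only [Finset.univ_unique, Finset.sum_singleton, Finset.univ_eq_empty, Finset.prod_empty] using hasSum_fintype (fun m : Fin 0 → ℕ ↦ ∏ i, f i (m i))
  | succ n ih =>
    obtain ⟨h1, h2⟩ := ih (f := fun i ↦ f i.succ) (s := fun i ↦ s i.succ)
      (fun i ↦ hf _) (fun i ↦ hs _)
    have e : ∀ p : ℕ × (Fin n → ℕ), ∏ i, f i (Fin.consEquiv (fun _ ↦ ℕ) p i) =
        f 0 p.1 * ∏ i, f (Fin.succ i) (p.2 i) := by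
      intro p; simp [Fin.prod_univ_succ, Fin.consEquiv]
    have h3 : Summable fun p : ℕ × (Fin n → ℕ) ↦ f 0 p.1 * ∏ i, f (Fin.succ i) (p.2 i) :=
      summable_mul_of_summable_norm (f := f 0) (g := fun m : Fin n → ℕ ↦ ∏ i, f (Fin.succ i) (m i))
        (hf 0) h1
    constructor
    · rw [← (Fin.consEquiv fun _ ↦ ℕ).summable_iff]
      refine h3.norm.congr fun p ↦ ?_
      simp only [Function.comp_apply, e]
    · rw [← (Fin.consEquiv fun _ ↦ ℕ).hasSum_iff, Fin.prod_univ_succ]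
      have := HasSum.mul (hs 0) h2 h3
      exact this.congr_fun e

/-! ### Euler integral representation on the cut domain -/

/-- The Euler weight `t ^ (α - 1) * (1 - t) ^ (γ - α - 1)`. -/
noncomputable def eulerWeight (α γ : ℂ) (t : ℝ) : ℂ :=
  (t : ℂ) ^ (α - 1) * (1 - (t : ℂ)) ^ (γ - α - 1)

/-- The integrand `∏ (1 - x i) ^ (-β i)` of the Euler integral of the Lauricella function. -/
noncomputable def lauricellaKernel {n : ℕ} (β : Fin n → ℂ) (x : Fin n → ℂ) : ℂ :=
  ∏ i, (1 - x i) ^ (-β i)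

/-- The Euler integral of the Lauricella function, without its normalising factor. -/
noncomputable def lauricellaIntegral {n : ℕ} (α : ℂ) (β : Fin n → ℂ) (γ : ℂ) (x : Fin n → ℂ) : ℂ :=
  ∫ t in Ioo (0 : ℝ) 1, eulerWeight α γ t * lauricellaKernel β ((t : ℂ) • x)

theorem integrableOn_eulerWeight {α γ : ℂ} (hα : 0 < α.re) (hγ : 0 < (γ - α).re) :
    IntegrableOn (eulerWeight α γ) (Ioo 0 1) := by
  have := Complex.betaIntegral_convergent hα hγ
  rw [intervalIntegrable_iff_integrableOn_Ioo_of_le zero_le_one] at this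
  exact this

/-- The factor t^m shifts α by m in the Beta integral; the Gamma recursion then yields the
coefficient (α)_m / (γ)_m of the Lauricella series. -/
theorem integral_eulerWeight_mul_pow {α γ : ℂ} (hα : 0 < α.re) (hγ : 0 < (γ - α).re) (m : ℕ) :
    ∫ t in Ioo (0 : ℝ) 1, eulerWeight α γ t * (t : ℂ) ^ m =
      Complex.betaIntegral α (γ - α) * (pochhammerSymbol α m / pochhammerSymbol γ m) := by
  have hγ' : 0 < γ.re := by rw [Complex.sub_re] at hγ; linarith
  have h1 : ∫ t in Ioo (0 : ℝ) 1, eulerWeight α γ t * (t : ℂ) ^ m =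
      Complex.betaIntegral (α + m) (γ - α) := by
    rw [Complex.betaIntegral, intervalIntegral.integral_of_le zero_le_one, integral_Ioc_eq_integral_Ioo]
    refine setIntegral_congr_fun measurableSet_Ioo fun t ht ↦ ?_
    have : (t : ℂ) ≠ 0 := by exact_mod_cast ht.1.ne'
    simp only [eulerWeight]
    rw [show α + m - 1 = (α - 1) + m by ring, Complex.cpow_add _ _ this, Complex.cpow_natCast]
    ring
  have hne : ∀ {z : ℂ}, 0 < z.re → ∀ k : ℕ, z ≠ -k := by
    intro z hz k hk
    rw [hk] at hz
    simp at hz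
    linarith [(Nat.cast_nonneg k : (0 : ℝ) ≤ k)]
  have hm : (0 : ℝ) ≤ m := Nat.cast_nonneg m
  rw [h1, Complex.betaIntegral_eq_Gamma_mul_div _ _ (by simp; linarith) hγ,
    Complex.betaIntegral_eq_Gamma_mul_div _ _ hα hγ, pochhammerSymbol, pochhammerSymbol,
    ← Complex.Gamma_add_nat_div_Gamma_eq _ (hne hα), ← Complex.Gamma_add_nat_div_Gamma_eq _ (hne hγ'),
    show α + m + (γ - α) = γ + m by ring, show α + (γ - α) = γ by ring]
  have g1 := Complex.Gamma_ne_zero_of_re_pos hα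
  have g2 := Complex.Gamma_ne_zero_of_re_pos hγ'
  have g3 : Complex.Gamma (γ + m) ≠ 0 := Complex.Gamma_ne_zero_of_re_pos (by simp; linarith)
  field_simp

theorem lauricellaIntegral_eq_series {n : ℕ} {α γ : ℂ} (β : Fin n → ℂ) (hα : 0 < α.re)
    (hγ : 0 < (γ - α).re) {x : Fin n → ℂ} (hx : ∀ i, ‖x i‖ < 1) :
    lauricellaIntegral α β γ x =
      Complex.betaIntegral α (γ - α) * lauricellaSeries α β γ x := by
  set c : (Fin n → ℕ) → ℂ := fun m ↦ ∏ i, (pochhammerSymbol (β i) (m i) / ((m i).factorial : ℂ) * x i ^ m i)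
  have hc : Summable fun m ↦ ‖c m‖ :=
    (summable_norm_and_hasSum_prod_fin (fun i ↦ (summable_norm_and_hasSum_one_sub_cpow (β i) (hx i)).1)
      (fun i ↦ (summable_norm_and_hasSum_one_sub_cpow (β i) (hx i)).2)).1
  have hk : ∀ t ∈ Ioo (0 : ℝ) 1, HasSum (fun m : Fin n → ℕ ↦ c m * (t : ℂ) ^ (∑ i, m i))
      (lauricellaKernel β ((t : ℂ) • x)) := by
    intro t ht
    have htx : ∀ i, ‖((t : ℂ) • x) i‖ < 1 := by
      intro i
      simp only [Pi.smul_apply, smul_eq_mul, norm_mul, Complex.norm_real, Real.norm_eq_abs, abs_of_pos ht.1]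
      nlinarith [hx i, ht.1, ht.2, norm_nonneg (x i)]
    refine (summable_norm_and_hasSum_prod_fin
      (fun i ↦ (summable_norm_and_hasSum_one_sub_cpow (β i) (htx i)).1)
      (fun i ↦ (summable_norm_and_hasSum_one_sub_cpow (β i) (htx i)).2)).2.congr_fun fun m ↦ ?_
    simp only [c, ← Finset.prod_pow_eq_pow_sum, Pi.smul_apply, smul_eq_mul, mul_pow]
    rw [← Finset.prod_mul_distrib]
    exact Finset.prod_congr rfl fun i _ ↦ by ring
  have hw := integrableOn_eulerWeight hα hγ
  have hint : ∀ k : ℕ, IntegrableOn (fun t : ℝ ↦ eulerWeight α γ t * (t : ℂ) ^ k) (Ioo 0 1) := by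
    intro k
    refine Integrable.mono hw (hw.aestronglyMeasurable.mul
      (by fun_prop : Continuous fun t : ℝ ↦ (t : ℂ) ^ k).aestronglyMeasurable) ?_
    filter_upwards [ae_restrict_mem measurableSet_Ioo] with t ht
    rw [norm_mul, norm_pow, Complex.norm_real, Real.norm_eq_abs, abs_of_pos ht.1]
    exact mul_le_of_le_one_right (norm_nonneg _) (pow_le_one₀ ht.1.le ht.2.le)
  -- Since |t^k| ≤ 1, the m-th term has L¹ norm at most ‖c m‖ ∫ ‖weight‖, which is summable; this
  -- justifies termwise integration.
  have key := hasSum_integral_of_summable_integral_norm (μ := volume.restrict (Ioo (0 : ℝ) 1))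
    (F := fun (m : Fin n → ℕ) t ↦ c m * (eulerWeight α γ t * (t : ℂ) ^ (∑ i, m i)))
    (fun m ↦ (hint _).const_mul _) (by
      refine Summable.of_nonneg_of_le (fun m ↦ integral_nonneg fun _ ↦ norm_nonneg _) (fun m ↦ ?_)
        (hc.mul_right (∫ t in Ioo (0 : ℝ) 1, ‖eulerWeight α γ t‖))
      simp only [norm_mul (c m)]
      rw [integral_const_mul]
      refine mul_le_mul_of_nonneg_left ?_ (norm_nonneg _)
      refine integral_mono_ae (hint _).norm hw.norm ?_
      filter_upwards [ae_restrict_mem measurableSet_Ioo] with t ht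
      rw [norm_mul, norm_pow, Complex.norm_real, Real.norm_eq_abs, abs_of_pos ht.1]
      exact mul_le_of_le_one_right (norm_nonneg _) (pow_le_one₀ ht.1.le ht.2.le))
  have e1 : lauricellaIntegral α β γ x = ∫ t in Ioo (0 : ℝ) 1, ∑' m : Fin n → ℕ,
      c m * (eulerWeight α γ t * (t : ℂ) ^ (∑ i, m i)) := by
    refine setIntegral_congr_fun measurableSet_Ioo fun t ht ↦ ?_
    rw [← (hk t ht).tsum_eq, ← tsum_mul_left]
    exact tsum_congr fun m ↦ by ring
  rw [e1, ← key.tsum_eq, lauricellaSeries, ← tsum_mul_left]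
  refine tsum_congr fun m ↦ ?_
  rw [integral_const_mul, integral_eulerWeight_mul_pow hα hγ, lauricellaTerm]
  simp only [c, Finset.prod_mul_distrib, Finset.prod_div_distrib]
  ring

theorem isOpen_lauricellaDomain (n : ℕ) : IsOpen (lauricellaDomain n) := by
  have : lauricellaDomain n = ⋂ i, (fun x : Fin n → ℂ ↦ 1 - x i) ⁻¹' Complex.slitPlane := by
    ext x; simp [lauricellaDomain]
  rw [this]
  exact isOpen_iInter_of_finite fun i ↦ Complex.isOpen_slitPlane.preimage (by fun_prop)

theorem smul_mem_lauricellaDomain {n : ℕ} {x : Fin n → ℂ} (hx : x ∈ lauricellaDomain n) {t : ℝ}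
    (ht : t ∈ Icc (0 : ℝ) 1) : (t : ℂ) • x ∈ lauricellaDomain n := by
  intro i
  have h := hx i
  simp only [Complex.mem_slitPlane_iff, Complex.sub_re, Complex.one_re, Complex.sub_im,
    Complex.one_im, Pi.smul_apply, smul_eq_mul, Complex.re_ofReal_mul, Complex.im_ofReal_mul] at h ⊢
  rcases eq_or_lt_of_le ht.1 with h0 | h0
  · left; simp [← h0]
  · rcases h with h | h
    · left; nlinarith [ht.2]
    · right; simpa [h0.ne'] using h

theorem analyticAt_lauricellaKernel {n : ℕ} (β : Fin n → ℂ) {x : Fin n → ℂ}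
    (hx : x ∈ lauricellaDomain n) : AnalyticAt ℂ (lauricellaKernel β) x := by
  refine Finset.analyticAt_fun_prod _ fun i _ ↦ ?_
  exact (analyticAt_const.sub ((ContinuousLinearMap.proj (R := ℂ) (φ := fun _ : Fin n ↦ ℂ) i).analyticAt x)).cpow
    analyticAt_const (hx i)

theorem continuousOn_lauricellaKernel_smul {n : ℕ} (β : Fin n → ℂ) {x : Fin n → ℂ}
    (hx : x ∈ lauricellaDomain n) :
    ContinuousOn (fun t : ℝ ↦ lauricellaKernel β ((t : ℂ) • x)) (Icc 0 1) := fun t ht ↦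
  ((analyticAt_lauricellaKernel β (smul_mem_lauricellaDomain hx ht)).continuousAt.comp
    (f := fun t : ℝ ↦ (t : ℂ) • x) (by fun_prop)).continuousWithinAt

theorem integrableOn_eulerWeight_mul {α γ : ℂ} (hα : 0 < α.re) (hγ : 0 < (γ - α).re) {g : ℝ → ℂ}
    (hg : ContinuousOn g (Icc 0 1)) :
    IntegrableOn (fun t : ℝ ↦ eulerWeight α γ t * g t) (Ioo 0 1) := by
  rw [← integrableOn_Icc_iff_integrableOn_Ioo]
  exact ((integrableOn_Icc_iff_integrableOn_Ioo).2 (integrableOn_eulerWeight hα hγ)).mul_continuousOn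
    hg isCompact_Icc

theorem differentiableOn_lauricellaIntegral {n : ℕ} {α γ : ℂ} (β : Fin n → ℂ) (hα : 0 < α.re)
    (hγ : 0 < (γ - α).re) :
    DifferentiableOn ℂ (lauricellaIntegral α β γ) (lauricellaDomain n) := by
  intro x₀ hx₀
  obtain ⟨ε, hε, hball⟩ := Metric.nhds_basis_closedBall.mem_iff.1
    ((isOpen_lauricellaDomain n).mem_nhds hx₀)
  -- The segments from 0 to points of the ball sweep out a compact set, inside the domain by
  -- star-shapedness. The derivative of the kernel is bounded there by some M, so M times the weight
  -- dominates.
  set S : Set (Fin n → ℂ) := (fun p : ℝ × (Fin n → ℂ) ↦ (p.1 : ℂ) • p.2) ''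
    (Icc (0 : ℝ) 1 ×ˢ Metric.closedBall x₀ ε) with hS
  have hSc : IsCompact S :=
    (isCompact_Icc.prod (isCompact_closedBall x₀ ε)).image (by fun_prop)
  have hSd : S ⊆ lauricellaDomain n := by
    rintro _ ⟨⟨t, x⟩, ⟨ht, hx⟩, rfl⟩
    exact smul_mem_lauricellaDomain (hball hx) ht
  have hcont : ContinuousOn (fderiv ℂ (lauricellaKernel β)) (lauricellaDomain n) := fun x hx ↦
    (analyticAt_lauricellaKernel β hx).fderiv.continuousAt.continuousWithinAt
  obtain ⟨M, hM⟩ := hSc.exists_bound_of_continuousOn (hcont.mono hSd)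
  have hw := integrableOn_eulerWeight hα hγ
  have hint : ∀ x ∈ lauricellaDomain n, IntegrableOn
      (fun t : ℝ ↦ eulerWeight α γ t * lauricellaKernel β ((t : ℂ) • x)) (Ioo 0 1) := fun x hx ↦
    integrableOn_eulerWeight_mul hα hγ (continuousOn_lauricellaKernel_smul β hx)
  have key := hasFDerivAt_integral_of_dominated_of_fderiv_le (𝕜 := ℂ)
    (μ := volume.restrict (Ioo (0 : ℝ) 1))
    (F := fun x (t : ℝ) ↦ eulerWeight α γ t * lauricellaKernel β ((t : ℂ) • x))
    (F' := fun x (t : ℝ) ↦ (eulerWeight α γ t * t) • fderiv ℂ (lauricellaKernel β) ((t : ℂ) • x))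
    (x₀ := x₀) (bound := fun t ↦ ‖eulerWeight α γ t‖ * M) (Metric.closedBall_mem_nhds x₀ hε)
    (by
      filter_upwards [(isOpen_lauricellaDomain n).mem_nhds hx₀] with x hx
      exact (hint x hx).aestronglyMeasurable)
    (hint x₀ hx₀)
    (by
      refine AEStronglyMeasurable.smul (hw.aestronglyMeasurable.mul
        (by fun_prop : Continuous fun t : ℝ ↦ (t : ℂ)).aestronglyMeasurable) ?_
      refine ContinuousOn.aestronglyMeasurable (fun t ht ↦ ?_) measurableSet_Ioo
      exact ((analyticAt_lauricellaKernel β (smul_mem_lauricellaDomain hx₀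
        (Ioo_subset_Icc_self ht))).fderiv.continuousAt.comp
        (f := fun t : ℝ ↦ (t : ℂ) • x₀) (by fun_prop)).continuousWithinAt)
    (by
      filter_upwards [ae_restrict_mem measurableSet_Ioo] with t ht x hx
      rw [norm_smul, norm_mul, Complex.norm_real, Real.norm_eq_abs, abs_of_pos ht.1, mul_assoc]
      refine mul_le_mul_of_nonneg_left ?_ (norm_nonneg _)
      have := hM _ ⟨(t, x), ⟨Ioo_subset_Icc_self ht, hx⟩, rfl⟩
      exact (mul_le_of_le_one_left (norm_nonneg _) ht.2.le).trans this)
    (hw.norm.mul_const M)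
    (by
      filter_upwards [ae_restrict_mem measurableSet_Ioo] with t ht x hx
      have h1 := (analyticAt_lauricellaKernel β (smul_mem_lauricellaDomain (hball hx)
        (Ioo_subset_Icc_self ht))).differentiableAt.hasFDerivAt
      have h2 : HasFDerivAt (fun x : Fin n → ℂ ↦ (t : ℂ) • x)
        ((t : ℂ) • ContinuousLinearMap.id ℂ (Fin n → ℂ)) x := (hasFDerivAt_id x).const_smul (t : ℂ)
      convert! (h1.comp x h2).const_mul (eulerWeight α γ t) using 1
      ext v
      simp [mul_assoc])
  exact key.differentiableAt.differentiableWithinAt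

/-- Restriction to the complex line through 0 and x reduces this to the one-variable identity
theorem: the slice of the domain is open and star-shaped about 0, and near 0 both functions equal
the series. -/
theorem IsLauricellaContinuation.eqOn {n : ℕ} {α γ : ℂ} {β : Fin n → ℂ} {F G : (Fin n → ℂ) → ℂ}
    (hF : IsLauricellaContinuation α β γ F) (hG : IsLauricellaContinuation α β γ G) :
    EqOn F G (lauricellaDomain n) := by
  intro x hx
  set U : Set ℂ := {z | z • x ∈ lauricellaDomain n} with hU
  have hUo : IsOpen U := (isOpen_lauricellaDomain n).preimage (by fun_prop)
  have h0 : (0 : ℂ) ∈ U := by simp [hU, lauricellaDomain]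
  have h1 : (1 : ℂ) ∈ U := by simpa [hU] using hx
  have hstar : StarConvex ℝ 0 U := by
    rw [starConvex_zero_iff]
    intro z hz t ht0 ht1
    have := smul_mem_lauricellaDomain hz ⟨ht0, ht1⟩
    rwa [smul_smul] at this
  have hconn : IsPreconnected U := (hstar.isPathConnected h0).isConnected.isPreconnected
  have han : ∀ {H : (Fin n → ℂ) → ℂ}, DifferentiableOn ℂ H (lauricellaDomain n) →
      AnalyticOnNhd ℂ (fun z : ℂ ↦ H (z • x)) U := fun hH ↦
    (hH.comp (s := U) (f := fun z : ℂ ↦ z • x) (by fun_prop) fun z hz ↦ hz).analyticOnNhd hUo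
  have hev : (fun z : ℂ ↦ F (z • x)) =ᶠ[𝓝 0] fun z ↦ G (z • x) := by
    have : ∀ᶠ z : ℂ in 𝓝 0, ‖z • x‖ < 1 := by
      refine ContinuousAt.eventually_lt (by fun_prop) continuousAt_const (by simp)
    filter_upwards [this] with z hz
    have hz' := fun i ↦ (norm_le_pi_norm (z • x) i).trans_lt hz
    rw [hF.2 _ hz', hG.2 _ hz']
  simpa using (han hF.1).eqOn_of_preconnected_of_eventuallyEq (han hG.1) hconn h0 hev h1

/-- The normalised Euler integral is itself a continuation, so one exists, and uniqueness identifies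
it with the one chosen in `lauricellaFD`. -/
theorem betaIntegral_mul_lauricellaFD {n : ℕ} {α γ : ℂ} (β : Fin n → ℂ) (hα : 0 < α.re)
    (hγ : 0 < (γ - α).re) {x : Fin n → ℂ} (hx : x ∈ lauricellaDomain n) :
    Complex.betaIntegral α (γ - α) * lauricellaFD α β γ x = lauricellaIntegral α β γ x := by
  have hB : Complex.betaIntegral α (γ - α) ≠ 0 := by
    rw [Complex.betaIntegral_eq_Gamma_mul_div _ _ hα hγ]
    refine div_ne_zero (mul_ne_zero (Complex.Gamma_ne_zero_of_re_pos hα)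
      (Complex.Gamma_ne_zero_of_re_pos hγ)) (Complex.Gamma_ne_zero_of_re_pos ?_)
    rw [Complex.add_re]; exact add_pos hα hγ
  have hc : IsLauricellaContinuation α β γ
      fun x ↦ (Complex.betaIntegral α (γ - α))⁻¹ * lauricellaIntegral α β γ x := by
    refine ⟨(differentiableOn_lauricellaIntegral β hα hγ).const_mul _, fun y hy ↦ ?_⟩
    beta_reduce
    rw [lauricellaIntegral_eq_series β hα hγ hy, inv_mul_cancel_left₀ hB]
  have h : x ∈ lauricellaDomain n ∧ ∃ F : (Fin n → ℂ) → ℂ, IsLauricellaContinuation α β γ F :=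
    ⟨hx, _, hc⟩
  rw [lauricellaFD, dif_pos h, h.2.choose_spec.eqOn hc hx, mul_inv_cancel_left₀ hB]

/-! ### Changes of variable for the elliptic integral -/

theorem StrictMonoOn.image_Ioo_of_continuousOn {f : ℝ → ℝ} {a b : ℝ} (hab : a ≤ b)
    (hf : StrictMonoOn f (Icc a b)) (hc : ContinuousOn f (Icc a b)) :
    f '' Ioo a b = Ioo (f a) (f b) := by
  refine Subset.antisymm ?_ (intermediate_value_Ioo hab hc)
  rintro _ ⟨x, hx, rfl⟩
  exact ⟨hf (left_mem_Icc.2 hab) (Ioo_subset_Icc_self hx) hx.1,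
    hf (Ioo_subset_Icc_self hx) (right_mem_Icc.2 hab) hx.2⟩

theorem ellipticK_eq_setIntegral (k : ℝ) :
    ellipticK k = ∫ u in Ioo (0 : ℝ) 1, 1 / √((1 - u ^ 2) * (1 - k ^ 2 * u ^ 2)) := by
  rw [ellipticK, intervalIntegral.integral_of_le zero_le_one, integral_Ioc_eq_integral_Ioo]

/-- Substitute u² = q(t) = 2(1+s²)t / ((1+t)(1+s²t)), a function invariant under t ↦ 1/(s²t).
Replacing s by -s changes only the modulus and the numerator 1 + st. -/
theorem ellipticK_eq_genusTwo {s : ℝ} (hs : |s| < 1) :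
    ellipticK ((1 + s) / √(2 * (1 + s ^ 2))) =
      √((1 + s ^ 2) / 2) *
        ∫ t in Ioo (0 : ℝ) 1, (1 + s * t) / √(t * (1 - t ^ 2) * (1 - s ^ 4 * t ^ 2)) := by
  obtain ⟨hs1, hs2⟩ := abs_lt.1 hs
  have hk0 : 0 ≤ s ^ 2 := sq_nonneg s
  have hk1 : s ^ 2 < 1 := by nlinarith
  set q : ℝ → ℝ := fun t ↦ 2 * (1 + s ^ 2) * t / ((1 + t) * (1 + s ^ 2 * t)) with hq
  have hd : ∀ t ∈ Icc (0 : ℝ) 1, 0 < (1 + t) * (1 + s ^ 2 * t) := fun t ht ↦ by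
    have := mul_nonneg hk0 ht.1
    have := ht.1
    positivity
  have hqmono : StrictMonoOn q (Icc 0 1) := by
    intro x hx y hy hxy
    simp only [hq]
    rw [div_lt_div_iff₀ (hd x hx) (hd y hy)]
    have h1 : s ^ 2 * (x * y) < 1 := by
      have : x * y ≤ 1 := mul_le_one₀ hx.2 hy.1 hy.2
      nlinarith [mul_nonneg hx.1 hy.1]
    nlinarith [mul_pos (mul_pos (by positivity : 0 < 2 * (1 + s ^ 2)) (sub_pos.2 hxy)) (sub_pos.2 h1)]
  have hqnn : ∀ t ∈ Icc (0 : ℝ) 1, 0 ≤ q t := fun t ht ↦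
    div_nonneg (mul_nonneg (by positivity) ht.1) (hd t ht).le
  have hmono : StrictMonoOn (fun t ↦ √(q t)) (Icc 0 1) := fun x hx y hy hxy ↦
    Real.sqrt_lt_sqrt (hqnn x hx) (hqmono hx hy hxy)
  have hcont : ContinuousOn (fun t ↦ √(q t)) (Icc 0 1) :=
    ContinuousOn.sqrt (ContinuousOn.div (by fun_prop) (by fun_prop) fun t ht ↦ (hd t ht).ne')
  have himg := hmono.image_Ioo_of_continuousOn (a := 0) (b := 1) zero_le_one hcont
  have h0 : √(q 0) = 0 := by simp [hq]
  have h1 : √(q 1) = 1 := by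
    rw [show q 1 = 1 by simp only [hq]; field_simp; ring, Real.sqrt_one]
  simp only [h0, h1] at himg
  rw [ellipticK_eq_setIntegral]
  conv_lhs => rw [← himg]
  rw [integral_image_eq_integral_abs_deriv_smul (measurableSet_Ioo (a := (0 : ℝ)) (b := 1))
    (f' := fun t ↦ 2 * (1 + s ^ 2) * (1 - s ^ 2 * t ^ 2) / ((1 + t) * (1 + s ^ 2 * t)) ^ 2 /
      (2 * √(q t))) ?_ (hmono.injOn.mono Ioo_subset_Icc_self), ← integral_const_mul]
  · refine setIntegral_congr_fun measurableSet_Ioo fun t ht ↦ ?_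
    have hdt := hd t (Ioo_subset_Icc_self ht)
    have hqt : 0 < q t := div_pos (mul_pos (by positivity) ht.1) hdt
    have hA : 0 < 1 + t := by linarith [ht.1]
    have hB : 0 < 1 + s ^ 2 * t := (pos_iff_pos_of_mul_pos hdt).1 hA
    have hC : 0 < 1 - t := by linarith [ht.2]
    have hD : 0 < 1 - s ^ 2 * t := by nlinarith [ht.1, ht.2]
    have hE : 0 < 1 - s * t := by nlinarith [ht.1, ht.2]
    have hF : 0 < 1 + s * t := by nlinarith [ht.1, ht.2]
    have hG : 0 < 1 - s ^ 2 * t ^ 2 := by nlinarith [mul_pos hE hF]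
    have ht0 := ht.1
    have e1 : 1 - q t = (1 - t) * (1 - s ^ 2 * t) / ((1 + t) * (1 + s ^ 2 * t)) := by
      simp only [hq]; field_simp; ring
    -- The modulus is chosen to make this numerator a perfect square. Its root 1 - st cancels
    -- against 1 - s²t² in the derivative of q, leaving 1 + st.
    have e2 : 1 - ((1 + s) / √(2 * (1 + s ^ 2))) ^ 2 * q t =
        (1 - s * t) ^ 2 / ((1 + t) * (1 + s ^ 2 * t)) := by
      rw [div_pow, Real.sq_sqrt (by positivity)]
      simp only [hq]; field_simp; ring
    have e3 : t * (1 - t ^ 2) * (1 - s ^ 4 * t ^ 2) =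
        t * ((1 - t) * (1 + t)) * ((1 - s ^ 2 * t) * (1 + s ^ 2 * t)) := by ring
    simp only [smul_eq_mul, Real.sq_sqrt hqt.le]
    rw [e1, e2, e3, abs_of_pos (by positivity)]
    rw [← sq_eq_sq₀ (by positivity) (by positivity)]
    simp only [mul_pow, div_pow, one_pow]
    rw [Real.sq_sqrt hqt.le, Real.sq_sqrt (by positivity), Real.sq_sqrt (by positivity),
      Real.sq_sqrt (by positivity)]
    rw [show 1 - s ^ 2 * t ^ 2 = (1 - s * t) * (1 + s * t) by ring]
    simp only [hq]
    field_simp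
  · intro t ht
    have hdt := hd t (Ioo_subset_Icc_self ht)
    have hqt : 0 < q t := div_pos (mul_pos (by positivity) ht.1) hdt
    refine (HasDerivAt.sqrt ?_ hqt.ne').hasDerivWithinAt
    have := ((hasDerivAt_id t).const_mul (2 * (1 + s ^ 2))).div
      (((hasDerivAt_id t).const_add 1).mul (((hasDerivAt_id t).const_mul (s ^ 2)).const_add 1))
      hdt.ne'
    refine this.congr_deriv ?_
    simp only [id, Pi.mul_apply]
    congr 1
    ring

theorem integral_Ioo_neg_one_one_of_even (g : ℝ → ℝ) (hg : ∀ y, g |y| = g y) :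
    ∫ y in Ioo (-1 : ℝ) 1, g y = 2 * ∫ y in Ioo (0 : ℝ) 1, g y := by
  have h := integral_comp_abs (f := (Iio (1 : ℝ)).indicator g)
  rw [setIntegral_indicator measurableSet_Iio, Ioi_inter_Iio] at h
  rw [← h, ← integral_indicator measurableSet_Ioo]
  congr 1
  ext y
  simp only [indicator, mem_Ioo, mem_Iio, abs_lt, hg]

/-- Substitution u = √(1-y²). No bound on k is needed: the factor 1 - k²u² is only rewritten,
whatever its sign. -/
theorem ellipticK_eq_complementary {k : ℝ} :
    ellipticK k = ∫ y in Ioo (0 : ℝ) 1, 1 / √((1 - y ^ 2) * (1 - k ^ 2 * (1 - y ^ 2))) := by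
  have himg : (fun y : ℝ ↦ √(1 - y ^ 2)) '' Ioo 0 1 = Ioo 0 1 := by
    have key : ∀ y ∈ Ioo (0 : ℝ) 1, √(1 - y ^ 2) ∈ Ioo (0 : ℝ) 1 := fun y hy ↦
      ⟨Real.sqrt_pos.2 (by nlinarith [hy.1, hy.2]),
        (Real.sqrt_lt' one_pos).2 (by nlinarith [hy.1, hy.2])⟩
    refine Subset.antisymm (image_subset_iff.2 key) fun y hy ↦ ⟨_, key y hy, ?_⟩
    simp only
    rw [Real.sq_sqrt (by nlinarith [hy.1, hy.2]), sub_sub_cancel, Real.sqrt_sq hy.1.le]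
  have hinj : InjOn (fun y : ℝ ↦ √(1 - y ^ 2)) (Ioo 0 1) := by
    intro x hx y hy hxy
    have := (Real.sqrt_inj (by nlinarith [hx.1, hx.2]) (by nlinarith [hy.1, hy.2])).1 hxy
    exact (sq_eq_sq₀ hx.1.le hy.1.le).1 (by linarith)
  rw [ellipticK_eq_setIntegral]
  conv_lhs => rw [← himg]
  rw [integral_image_eq_integral_abs_deriv_smul measurableSet_Ioo
    (f' := fun y ↦ -(2 * y) / (2 * √(1 - y ^ 2))) ?_ hinj]
  · refine setIntegral_congr_fun measurableSet_Ioo fun y hy ↦ ?_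
    have h1 : 0 < 1 - y ^ 2 := by nlinarith [hy.1, hy.2]
    have hy0 := hy.1
    simp only [smul_eq_mul]
    rw [Real.sq_sqrt h1.le, sub_sub_cancel, Real.sqrt_mul (sq_nonneg y), Real.sqrt_sq hy0.le,
      Real.sqrt_mul h1.le, neg_div, abs_neg, abs_of_pos (by positivity)]
    have := Real.sqrt_pos.2 h1
    field_simp
  · intro y hy
    have h1 : 0 < 1 - y ^ 2 := by nlinarith [hy.1, hy.2]
    have h2 : HasDerivAt (fun y : ℝ ↦ 1 - y ^ 2) (-(2 * y)) y := by
      simpa using ((hasDerivAt_id y).pow 2).const_sub 1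
    exact (h2.sqrt h1.ne').hasDerivWithinAt

/-- The substitution y = (r-v²)/(r+v²), that is v = √r tan(θ/2) with y = cos θ, maps (0, ∞) onto
(-1, 1); evenness in v and in y accounts for the half-ranges. -/
theorem integral_one_div_sqrt_biquadratic {r e k : ℝ} (hr : 0 < r) (hk : 2 * r * k ^ 2 = r - e)
    (her : -r < e) :
    ∫ v : ℝ, 1 / √(v ^ 4 + 2 * e * v ^ 2 + r ^ 2) = 2 / √r * ellipticK k := by
  have hpos : ∀ v : ℝ, 0 < v → 0 < v ^ 4 + 2 * e * v ^ 2 + r ^ 2 := by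
    intro v hv
    nlinarith [sq_nonneg (v ^ 2 - r), mul_pos (pow_pos hv 2) (by linarith : 0 < r + e)]
  have habs := integral_comp_abs (f := fun v : ℝ ↦ 1 / √(v ^ 4 + 2 * e * v ^ 2 + r ^ 2))
  simp only [sq_abs, show ∀ v : ℝ, |v| ^ 4 = v ^ 4 from fun v ↦ by
    rw [show 4 = 2 * 2 from rfl, pow_mul, sq_abs, ← pow_mul]] at habs
  have himg : (fun v : ℝ ↦ (r - v ^ 2) / (r + v ^ 2)) '' Ioi 0 = Ioo (-1) 1 := by
    ext y
    constructor
    · rintro ⟨v, hv, rfl⟩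
      have hv : 0 < v := hv
      constructor
      · rw [lt_div_iff₀ (by positivity)]; linarith
      · rw [div_lt_iff₀ (by positivity)]; nlinarith
    · rintro ⟨h1, h2⟩
      have h3 : 0 < r * (1 - y) / (1 + y) :=
        div_pos (mul_pos hr (by linarith)) (by linarith)
      refine ⟨√(r * (1 - y) / (1 + y)), Real.sqrt_pos.2 h3, ?_⟩
      simp only
      rw [Real.sq_sqrt h3.le]
      have h4 : 1 + y ≠ 0 := by linarith
      have h5 : r + r * (1 - y) / (1 + y) ≠ 0 := by positivity
      rw [div_eq_iff h5]
      field_simp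
      ring
  have hinj : InjOn (fun v : ℝ ↦ (r - v ^ 2) / (r + v ^ 2)) (Ioi 0) := by
    intro x hx y hy hxy
    have hx : 0 < x := hx
    have hy : 0 < y := hy
    simp only at hxy
    rw [div_eq_div_iff (by positivity) (by positivity)] at hxy
    have : r * (x ^ 2 - y ^ 2) = 0 := by linarith
    rcases mul_eq_zero.1 this with h | h
    · exact absurd h hr.ne'
    · exact (sq_eq_sq₀ hx.le hy.le).1 (by linarith)
  have h2 : ∫ y in Ioo (-1 : ℝ) 1, 1 / √((1 - y ^ 2) * (1 - k ^ 2 * (1 - y ^ 2))) =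
      2 * √r * ∫ v in Ioi (0 : ℝ), 1 / √(v ^ 4 + 2 * e * v ^ 2 + r ^ 2) := by
    rw [← himg, integral_image_eq_integral_abs_deriv_smul measurableSet_Ioi
      (f' := fun v ↦ -(4 * r * v / (r + v ^ 2) ^ 2)) ?_ hinj, ← integral_const_mul]
    · refine setIntegral_congr_fun measurableSet_Ioi fun v hv ↦ ?_
      have hv : 0 < v := hv
      have hQ := hpos v hv
      have e1 : 1 - ((r - v ^ 2) / (r + v ^ 2)) ^ 2 = 4 * r * v ^ 2 / (r + v ^ 2) ^ 2 := by
        field_simp; ring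
      have e2 : 1 - k ^ 2 * (4 * r * v ^ 2 / (r + v ^ 2) ^ 2) =
          (v ^ 4 + 2 * e * v ^ 2 + r ^ 2) / (r + v ^ 2) ^ 2 := by
        rw [show k ^ 2 * (4 * r * v ^ 2 / (r + v ^ 2) ^ 2) =
          (2 * r * k ^ 2) * (2 * v ^ 2 / (r + v ^ 2) ^ 2) by ring, hk]
        field_simp; ring
      simp only [smul_eq_mul]
      rw [e1, e2, abs_neg, abs_of_pos (by positivity), ← sq_eq_sq₀ (by positivity) (by positivity)]
      simp only [mul_pow, div_pow, one_pow]
      rw [Real.sq_sqrt (by positivity), Real.sq_sqrt (by positivity), Real.sq_sqrt (by positivity)]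
      field_simp
      ring
    · intro v hv
      have hv : 0 < v := hv
      have := (((hasDerivAt_id v).pow 2).const_sub r).div (((hasDerivAt_id v).pow 2).const_add r)
        (by simp; positivity)
      refine (this.congr_deriv ?_).hasDerivWithinAt
      simp
      field_simp
      ring
  rw [integral_Ioo_neg_one_one_of_even _ (fun y ↦ by simp only [sq_abs]),
    ← ellipticK_eq_complementary] at h2
  have h3 : ellipticK k =
      √r * ∫ v in Ioi (0 : ℝ), 1 / √(v ^ 4 + 2 * e * v ^ 2 + r ^ 2) := by linarith
  rw [habs, h3, ← mul_assoc, div_mul_cancel₀ _ (Real.sqrt_pos.2 hr).ne']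

/-! ### Evaluation of the four-variable and three-variable integrals -/

/-- The numerator w + c/w is what the differential of v = w - c/w produces. As v² + 2c = w² + c²/w²
and c² = ab, the biquadratic (v²+2c)² + (a-b)² equals (w⁴+a²)(w⁴+b²)/w⁴. -/
theorem integral_quartic_eq {a b c : ℝ} (ha : 0 < a) (hb : 0 < b) (hc : 0 < c)
    (habc : c ^ 2 = a * b) :
    ∫ t in Ioo (0 : ℝ) 1, (√(1 - t) / √t + c * (√t / √(1 - t))) /
        √(((1 - t) ^ 2 + a ^ 2 * t ^ 2) * ((1 - t) ^ 2 + b ^ 2 * t ^ 2)) =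
      2 * ∫ v : ℝ, 1 / √(v ^ 4 + 2 * (2 * c) * v ^ 2 + (a + b) ^ 2) := by
  set w : ℝ → ℝ := fun t ↦ √((1 - t) / t) with hw
  have hwpos : ∀ t ∈ Ioo (0 : ℝ) 1, 0 < w t := fun t ht ↦
    Real.sqrt_pos.2 (div_pos (by linarith [ht.2]) ht.1)
  have hwsq : ∀ t ∈ Ioo (0 : ℝ) 1, w t ^ 2 = (1 - t) / t := fun t ht ↦
    Real.sq_sqrt (div_pos (by linarith [ht.2]) ht.1).le
  have himg : (fun t ↦ w t - c / w t) '' Ioo 0 1 = univ := by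
    refine eq_univ_of_forall fun v ↦ ?_
    -- The positive root of y - c/y = v; the preimage is the t with w t = y.
    set y := (v + √(v ^ 2 + 4 * c)) / 2 with hy
    have h1 : √(v ^ 2 + 4 * c) ^ 2 = v ^ 2 + 4 * c := Real.sq_sqrt (by positivity)
    have h2 : |v| < √(v ^ 2 + 4 * c) := by
      rw [Real.lt_sqrt (abs_nonneg v), sq_abs]; linarith
    have hypos : 0 < y := by
      have := neg_abs_le v
      rw [hy]; linarith
    have hyq : y ^ 2 = v * y + c := by rw [hy]; linear_combination h1 / 4
    refine ⟨1 / (1 + y ^ 2), ⟨by positivity, by rw [div_lt_one (by positivity)]; nlinarith⟩, ?_⟩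
    have h3 : w (1 / (1 + y ^ 2)) = y := by
      simp only [hw]
      rw [show (1 - 1 / (1 + y ^ 2)) / (1 / (1 + y ^ 2)) = y ^ 2 by field_simp; ring,
        Real.sqrt_sq hypos.le]
    simp only [h3]
    field_simp
    linarith
  have hinj : InjOn (fun t ↦ w t - c / w t) (Ioo 0 1) := by
    intro x hx y hy hxy
    have h1 := hwpos x hx
    have h2 := hwpos y hy
    have h3 : (w x - w y) * (w x * w y + c) = 0 := by
      simp only at hxy
      field_simp at hxy
      linarith
    rcases mul_eq_zero.1 h3 with h | h
    · have h4 : (1 - x) / x = (1 - y) / y := by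
        rw [← hwsq x hx, ← hwsq y hy, sub_eq_zero.1 h]
      rw [div_eq_div_iff hx.1.ne' hy.1.ne'] at h4
      linarith
    · exact absurd h (by positivity)
  rw [← setIntegral_univ (μ := volume), ← himg, integral_image_eq_integral_abs_deriv_smul measurableSet_Ioo
    (f' := fun t ↦ -(1 / t ^ 2 / (2 * w t) * (1 + c / w t ^ 2))) ?_ hinj, ← integral_const_mul]
  · refine setIntegral_congr_fun measurableSet_Ioo fun t ht ↦ ?_
    have hwt := hwpos t ht
    have ht0 := ht.1
    have ht1 : 0 < 1 - t := by linarith [ht.2]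
    have e0 : √(1 - t) / √t = w t := (Real.sqrt_div ht1.le t).symm
    have e1 : √t / √(1 - t) = 1 / w t := by rw [← e0, one_div_div]
    have e2 : (w t - c / w t) ^ 4 + 2 * (2 * c) * (w t - c / w t) ^ 2 + (a + b) ^ 2 =
        ((1 - t) ^ 2 + a ^ 2 * t ^ 2) * ((1 - t) ^ 2 + b ^ 2 * t ^ 2) / (t ^ 2 * w t ^ 2) ^ 2 := by
      have h1 : (w t - c / w t) ^ 4 + 2 * (2 * c) * (w t - c / w t) ^ 2 + (a + b) ^ 2 =
          ((w t ^ 2) ^ 2 + a ^ 2) * ((w t ^ 2) ^ 2 + b ^ 2) / (w t ^ 2) ^ 2 := by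
        field_simp
        linear_combination (c ^ 2 + a * b - 2 * w t ^ 4) * habc
      rw [h1, hwsq t ht]
      field_simp
    simp only [smul_eq_mul]
    rw [e0, e1, e2, Real.sqrt_div (by positivity), Real.sqrt_sq (by positivity), abs_neg,
      abs_of_pos (by positivity)]
    have : 0 < √(((1 - t) ^ 2 + a ^ 2 * t ^ 2) * ((1 - t) ^ 2 + b ^ 2 * t ^ 2)) :=
      Real.sqrt_pos.2 (by positivity)
    field_simp
  · intro t ht
    have hwt := hwpos t ht
    have ht0 := ht.1
    have h1 : HasDerivAt (fun t : ℝ ↦ (1 - t) / t) (-(1 / t ^ 2)) t := by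
      refine (((hasDerivAt_id t).const_sub 1).div (hasDerivAt_id t) ht0.ne').congr_deriv ?_
      simp only [id]; field_simp; ring
    have h2 : HasDerivAt w (-(1 / t ^ 2) / (2 * w t)) t :=
      h1.sqrt (div_pos (by linarith [ht.2]) ht0).ne'
    refine ((h2.sub ((hasDerivAt_const t c).div h2 hwt.ne')).congr_deriv ?_).hasDerivWithinAt
    field_simp
    ring

/-- The Möbius involution φ of (0, 1) is w ↦ c/w written in the variable t. -/
theorem integral_quartic_reflect {a b c : ℝ} (hc : 0 < c) (habc : c ^ 2 = a * b) :
    ∫ t in Ioo (0 : ℝ) 1, √(1 - t) / √t /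
        √(((1 - t) ^ 2 + a ^ 2 * t ^ 2) * ((1 - t) ^ 2 + b ^ 2 * t ^ 2)) =
      c * ∫ t in Ioo (0 : ℝ) 1, √t / √(1 - t) /
        √(((1 - t) ^ 2 + a ^ 2 * t ^ 2) * ((1 - t) ^ 2 + b ^ 2 * t ^ 2)) := by
  have hN : ∀ t ∈ Ioo (0 : ℝ) 1, 0 < 1 - t + c ^ 2 * t := fun t ht ↦ by
    have := ht.1
    have := sub_pos.2 ht.2
    positivity
  set φ : ℝ → ℝ := fun t ↦ (1 - t) / (1 - t + c ^ 2 * t) with hφ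
  have hmaps : ∀ t ∈ Ioo (0 : ℝ) 1, φ t ∈ Ioo (0 : ℝ) 1 := fun t ht ↦ by
    have h1 := ht.1
    have h2 := sub_pos.2 ht.2
    refine ⟨div_pos h2 (hN t ht), (div_lt_one (hN t ht)).2 ?_⟩
    have : 0 < c ^ 2 * t := by positivity
    linarith
  have hinv : ∀ t ∈ Ioo (0 : ℝ) 1, φ (φ t) = t := fun t ht ↦ by
    have h1 := hN t ht
    have h2 : 1 - φ t = c ^ 2 * t / (1 - t + c ^ 2 * t) := by
      simp only [hφ]; rw [eq_div_iff h1.ne', sub_mul, div_mul_cancel₀ _ h1.ne']; ring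
    have h3 : 1 - φ t + c ^ 2 * φ t = c ^ 2 / (1 - t + c ^ 2 * t) := by
      rw [h2]; simp only [hφ]; field_simp; ring
    change (1 - φ t) / (1 - φ t + c ^ 2 * φ t) = t
    rw [h3, h2]
    field_simp
  have himg : φ '' Ioo 0 1 = Ioo 0 1 :=
    Subset.antisymm (image_subset_iff.2 hmaps) fun t ht ↦ ⟨φ t, hmaps t ht, hinv t ht⟩
  have hinj : InjOn φ (Ioo 0 1) := fun x hx y hy hxy ↦ by rw [← hinv x hx, ← hinv y hy, hxy]
  conv_lhs => rw [← himg]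
  rw [integral_image_eq_integral_abs_deriv_smul measurableSet_Ioo
    (f' := fun t ↦ -(c ^ 2 / (1 - t + c ^ 2 * t) ^ 2)) ?_ hinj, ← integral_const_mul]
  · refine setIntegral_congr_fun measurableSet_Ioo fun t ht ↦ ?_
    have h1 := hN t ht
    have ht0 := ht.1
    have ht1 : 0 < 1 - t := sub_pos.2 ht.2
    have h2 : 1 - φ t = c ^ 2 * t / (1 - t + c ^ 2 * t) := by
      simp only [hφ]; field_simp; ring
    have h3 : ((1 - φ t) ^ 2 + a ^ 2 * φ t ^ 2) * ((1 - φ t) ^ 2 + b ^ 2 * φ t ^ 2) =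
        ((1 - t) ^ 2 + a ^ 2 * t ^ 2) * ((1 - t) ^ 2 + b ^ 2 * t ^ 2) *
          ((c ^ 2) / (1 - t + c ^ 2 * t) ^ 2) ^ 2 := by
      rw [h2]
      simp only [hφ]
      field_simp
      rw [show c ^ 4 = (a * b) ^ 2 by rw [← habc]; ring]
      ring
    have h4 : √(1 - φ t) / √(φ t) = c * (√t / √(1 - t)) := by
      rw [h2, ← Real.sqrt_div (by positivity), ← Real.sqrt_div ht0.le]
      simp only [hφ]
      rw [div_div_div_cancel_right₀ h1.ne', mul_div_assoc, Real.sqrt_mul (by positivity),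
        Real.sqrt_sq hc.le]
    simp only [smul_eq_mul]
    rw [h3, h4, abs_neg, abs_of_pos (by positivity), Real.sqrt_mul (by positivity),
      Real.sqrt_sq (by positivity)]
    field_simp
  · intro t ht
    have h1 := hN t ht
    have h2 : HasDerivAt (fun t : ℝ ↦ 1 - t + c ^ 2 * t) (-1 + c ^ 2 * 1) t :=
      ((hasDerivAt_id t).const_sub 1).add ((hasDerivAt_id t).const_mul (c ^ 2))
    refine ((((hasDerivAt_id t).const_sub 1).div h2 h1.ne').congr_deriv ?_).hasDerivWithinAt
    simp only [id]
    field_simp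
    ring

theorem integral_quartic_eq_ellipticKMinus {a b : ℝ} (ha : 0 < a) (hb : 0 < b)
    (hC : IntegrableOn (fun t ↦ √t / √(1 - t) /
      √(((1 - t) ^ 2 + a ^ 2 * t ^ 2) * ((1 - t) ^ 2 + b ^ 2 * t ^ 2))) (Ioo 0 1))
    (hD : IntegrableOn (fun t ↦ √(1 - t) / √t /
      √(((1 - t) ^ 2 + a ^ 2 * t ^ 2) * ((1 - t) ^ 2 + b ^ 2 * t ^ 2))) (Ioo 0 1)) :
    ∫ t in Ioo (0 : ℝ) 1, √(1 - t) / √t /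
        √(((1 - t) ^ 2 + a ^ 2 * t ^ 2) * ((1 - t) ^ 2 + b ^ 2 * t ^ 2)) =
      2 / √(a + b) * ellipticKMinus a b := by
  have hc : 0 < √(a * b) := Real.sqrt_pos.2 (by positivity)
  have habc : √(a * b) ^ 2 = a * b := Real.sq_sqrt (by positivity)
  have h1 := integral_quartic_eq ha hb hc habc
  have h2 := integral_quartic_reflect hc habc
  simp only [add_div, mul_div_assoc] at h1
  rw [integral_add hD (hC.const_mul _), integral_const_mul, ← h2,
    integral_one_div_sqrt_biquadratic (r := a + b) (e := 2 * √(a * b))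
      (k := (√a - √b) / √(2 * (a + b))) (by positivity) ?_ (by linarith)] at h1
  · rw [ellipticKMinus]
    linarith
  · rw [div_pow, Real.sq_sqrt (by positivity), sub_sq, Real.sq_sqrt ha.le, Real.sq_sqrt hb.le,
      Real.sqrt_mul ha.le]
    field_simp
    ring

theorem integral_genusTwo_eq {a b : ℝ} (hb : 0 < b) (hab : b < a)
    (hA : IntegrableOn (fun t ↦ 1 / √(t * (1 - t ^ 2) * (1 - (b / a) ^ 2 * t ^ 2))) (Ioo 0 1))
    (hB : IntegrableOn (fun t ↦ t / √(t * (1 - t ^ 2) * (1 - (b / a) ^ 2 * t ^ 2))) (Ioo 0 1)) :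
    ∫ t in Ioo (0 : ℝ) 1, 1 / √(t * (1 - t ^ 2) * (1 - (b / a) ^ 2 * t ^ 2)) =
        √a / √(2 * (a + b)) * (ellipticKPlus a b + ellipticKMinus a b) ∧
      ∫ t in Ioo (0 : ℝ) 1, t / √(t * (1 - t ^ 2) * (1 - (b / a) ^ 2 * t ^ 2)) =
        a / √(2 * (b * (a + b))) * (ellipticKPlus a b - ellipticKMinus a b) := by
  have ha : 0 < a := hb.trans hab
  have hsa := Real.sqrt_pos.2 ha
  have hsb := Real.sqrt_pos.2 hb
  -- K₊ and K₋ come from the values s and -s, giving two linear equations for the two integrals.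
  set s := √b / √a with hs
  have hs0 : 0 < s := div_pos hsb hsa
  have hs1 : s < 1 := (div_lt_one hsa).2 (Real.sqrt_lt_sqrt hb.le hab)
  have hs2 : s ^ 2 = b / a := by rw [hs, div_pow, Real.sq_sqrt hb.le, Real.sq_sqrt ha.le]
  have hs4 : s ^ 4 = (b / a) ^ 2 := by rw [← hs2]; ring
  have hq : √(2 * (a + b)) = √a * √(2 * (1 + s ^ 2)) := by
    rw [← Real.sqrt_mul ha.le, hs2]; congr 1; field_simp
  have hp := ellipticK_eq_genusTwo (s := s) (by rwa [abs_of_pos hs0])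
  have hm := ellipticK_eq_genusTwo (s := -s) (by rwa [abs_neg, abs_of_pos hs0])
  rw [show (1 + s) / √(2 * (1 + s ^ 2)) = (√a + √b) / √(2 * (a + b)) by
    rw [hq, hs]; field_simp] at hp
  rw [show (1 + -s) / √(2 * (1 + (-s) ^ 2)) = (√a - √b) / √(2 * (a + b)) by
    rw [neg_sq, hq, hs]; field_simp; ring] at hm
  rw [show (-s) ^ 2 = s ^ 2 by ring, show (-s) ^ 4 = s ^ 4 by ring] at hm
  rw [hs4] at hp hm
  simp only [show ∀ r t x : ℝ, (1 + r * t) / x = 1 / x + r * (t / x) from fun r t x ↦ by ring]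
    at hp hm
  rw [integral_add hA (hB.const_mul _), integral_const_mul] at hp hm
  rw [← ellipticKPlus.eq_1] at hp
  rw [← ellipticKMinus.eq_1] at hm
  set A := ∫ t in Ioo (0 : ℝ) 1, 1 / √(t * (1 - t ^ 2) * (1 - (b / a) ^ 2 * t ^ 2))
  set B := ∫ t in Ioo (0 : ℝ) 1, t / √(t * (1 - t ^ 2) * (1 - (b / a) ^ 2 * t ^ 2))
  have h2 : 0 < √2 := by positivity
  have h22 : √2 ^ 2 = 2 := Real.sq_sqrt (by norm_num)
  have hab' : 0 < √(a + b) := Real.sqrt_pos.2 (by positivity)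
  have hr : √((1 + s ^ 2) / 2) = √(a + b) / (√2 * √a) := by
    rw [← Real.sqrt_mul (by norm_num), ← Real.sqrt_div (by positivity), hs2]
    congr 1; field_simp
  have ha2 : √a ^ 2 = a := Real.sq_sqrt ha.le
  rw [hr] at hp hm
  rw [hp, hm, Real.sqrt_mul (by norm_num) (a + b), Real.sqrt_mul (by norm_num) (b * (a + b)),
    Real.sqrt_mul hb.le, hs]
  constructor
  · field_simp
    rw [h22]; ring
  · field_simp
    rw [h22, ha2]; ring

/-! ### Real form of the Euler integrands and values of the Beta factor -/

/-- Positivity is recorded because it later shows that the Lauricella value in the denominator is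
nonzero. -/
theorem lauricellaIntegral_eq_ofReal {n : ℕ} {α γ : ℂ} {β : Fin n → ℂ} (hα : 0 < α.re)
    (hγ : 0 < (γ - α).re) {x : Fin n → ℂ} (hx : x ∈ lauricellaDomain n) {g : ℝ → ℝ}
    (hg : ∀ t ∈ Ioo (0 : ℝ) 1, eulerWeight α γ t * lauricellaKernel β ((t : ℂ) • x) = g t)
    (hpos : ∀ t ∈ Ioo (0 : ℝ) 1, 0 < g t) :
    IntegrableOn g (Ioo 0 1) ∧
      lauricellaIntegral α β γ x = ((∫ t in Ioo (0 : ℝ) 1, g t : ℝ) : ℂ) ∧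
      0 < ∫ t in Ioo (0 : ℝ) 1, g t := by
  have hint := integrableOn_eulerWeight_mul hα hγ (continuousOn_lauricellaKernel_smul β hx)
  have hgint : IntegrableOn g (Ioo 0 1) := by
    refine IntegrableOn.congr_fun (f := fun t ↦ (eulerWeight α γ t *
      lauricellaKernel β ((t : ℂ) • x)).re) hint.re (fun t ht ↦ ?_) measurableSet_Ioo
    simp only [hg t ht, Complex.ofReal_re]
  refine ⟨hgint, ?_, ?_⟩
  · rw [lauricellaIntegral, setIntegral_congr_fun measurableSet_Ioo hg]
    exact integral_ofReal
  · rw [setIntegral_pos_iff_support_of_nonneg_ae _ hgint]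
    · have hsub : Ioo (0 : ℝ) 1 ⊆ Function.support g := fun t ht ↦ (hpos t ht).ne'
      rw [inter_eq_right.2 hsub]
      simp
    · filter_upwards [ae_restrict_mem measurableSet_Ioo] with t ht using (hpos t ht).le

theorem ofReal_cpow_half {r : ℝ} (hr : 0 ≤ r) : (r : ℂ) ^ (1 / 2 : ℂ) = (√r : ℝ) := by
  rw [Real.sqrt_eq_rpow, Complex.ofReal_cpow hr]
  norm_num

theorem ofReal_cpow_neg_half {r : ℝ} (hr : 0 ≤ r) : (r : ℂ) ^ (-(1 / 2) : ℂ) = (1 / √r : ℝ) := by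
  rw [Complex.cpow_neg, ofReal_cpow_half hr]
  push_cast
  rw [one_div]

/-- Off the branch cut, guaranteed by u > 0, powers commute with conjugation, so the product is
|z|^(-1). -/
theorem cpow_neg_half_mul_conj {u v : ℝ} (hu : 0 < u) :
    (u - v * Complex.I : ℂ) ^ (-(1 / 2) : ℂ) * (u + v * Complex.I : ℂ) ^ (-(1 / 2) : ℂ) =
      (1 / √(u ^ 2 + v ^ 2) : ℝ) := by
  set z : ℂ := u + v * Complex.I with hz
  have hre : z.re = u := by simp [hz]
  have him : z.im = v := by simp [hz]
  have harg : z.arg ≠ Real.pi := by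
    rw [ne_eq, Complex.arg_eq_pi_iff, hre]
    exact fun h ↦ absurd h.1 hu.le.not_gt
  have hc : (u - v * Complex.I : ℂ) = (starRingEnd ℂ) z := by
    apply Complex.ext <;> simp [hz]
  have hp : (-(1 / 2) : ℂ) = ((-(1 / 2) : ℝ) : ℂ) := by push_cast; rfl
  rw [hc, hp, Complex.conj_cpow _ _ harg, mul_comm, Complex.conj_ofReal, Complex.mul_conj,
    Complex.normSq_eq_norm_sq, Complex.norm_cpow_real, ← Real.rpow_natCast, ← Real.rpow_mul (norm_nonneg z),
    Complex.norm_eq_sqrt_sq_add_sq, hre, him]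
  norm_num [Real.rpow_neg_one]

theorem eulerWeight_half_one {t : ℝ} (ht : t ∈ Ioo (0 : ℝ) 1) :
    eulerWeight (1 / 2) 1 t = (1 / √t * (1 / √(1 - t)) : ℝ) := by
  rw [eulerWeight, show (1 / 2 - 1 : ℂ) = -(1 / 2) by norm_num,
    show (1 - 1 / 2 - 1 : ℂ) = -(1 / 2) by norm_num, ofReal_cpow_neg_half ht.1.le,
    show (1 - t : ℂ) = ((1 - t : ℝ) : ℂ) by push_cast; rfl,
    ofReal_cpow_neg_half (sub_pos.2 ht.2).le, ← Complex.ofReal_mul]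

theorem eulerWeight_half_two {t : ℝ} (ht : t ∈ Ioo (0 : ℝ) 1) :
    eulerWeight (1 / 2) 2 t = (√(1 - t) / √t : ℝ) := by
  rw [eulerWeight, show (1 / 2 - 1 : ℂ) = -(1 / 2) by norm_num,
    show (2 - 1 / 2 - 1 : ℂ) = 1 / 2 by norm_num, ofReal_cpow_neg_half ht.1.le,
    show (1 - t : ℂ) = ((1 - t : ℝ) : ℂ) by push_cast; rfl,
    ofReal_cpow_half (sub_pos.2 ht.2).le, ← Complex.ofReal_mul, one_div_mul_eq_div]

theorem eulerWeight_threeHalves_two {t : ℝ} (ht : t ∈ Ioo (0 : ℝ) 1) :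
    eulerWeight (3 / 2) 2 t = (√t / √(1 - t) : ℝ) := by
  rw [eulerWeight, show (3 / 2 - 1 : ℂ) = 1 / 2 by norm_num,
    show (2 - 3 / 2 - 1 : ℂ) = -(1 / 2) by norm_num, ofReal_cpow_half ht.1.le,
    show (1 - t : ℂ) = ((1 - t : ℝ) : ℂ) by push_cast; rfl,
    ofReal_cpow_neg_half (sub_pos.2 ht.2).le, ← Complex.ofReal_mul, mul_one_div]

theorem lauricellaKernel_fin_three {x y z t : ℝ} (hx : 0 < 1 - t * x) (hy : 0 < 1 - t * y)
    (hz : 0 < 1 - t * z) :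
    lauricellaKernel (fun _ : Fin 3 ↦ 1 / 2) ((t : ℂ) • ![(x : ℂ), (y : ℂ), (z : ℂ)]) =
      (1 / √((1 - t * x) * (1 - t * y) * (1 - t * z)) : ℝ) := by
  have h : ∀ r : ℝ, (1 - t * r : ℂ) = ((1 - t * r : ℝ) : ℂ) := fun r ↦ by push_cast; rfl
  simp only [lauricellaKernel, Fin.prod_univ_three, Pi.smul_apply, smul_eq_mul,
    Matrix.cons_val, h]
  rw [ofReal_cpow_neg_half hx.le, ofReal_cpow_neg_half hy.le, ofReal_cpow_neg_half hz.le,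
    ← Complex.ofReal_mul, ← Complex.ofReal_mul, Real.sqrt_mul (by positivity), Real.sqrt_mul hx.le]
  congr 1
  field_simp

theorem mem_lauricellaDomain_fin_three {x y z : ℝ} (hx : x < 1) (hy : y < 1) (hz : z < 1) :
    ![(x : ℂ), (y : ℂ), (z : ℂ)] ∈ lauricellaDomain 3 := by
  intro i
  rw [Complex.mem_slitPlane_iff]
  left
  fin_cases i <;> simpa

theorem lauricellaKernel_conj_pairs {a b t : ℝ} (ht : t < 1) :
    lauricellaKernel (fun _ : Fin 4 ↦ 1 / 2) ((t : ℂ) • ![1 + Complex.I * a, 1 - Complex.I * a,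
      1 + Complex.I * b, 1 - Complex.I * b]) =
      (1 / √(((1 - t) ^ 2 + a ^ 2 * t ^ 2) * ((1 - t) ^ 2 + b ^ 2 * t ^ 2)) : ℝ) := by
  have h1 : ∀ r : ℝ, (1 - t * (1 + Complex.I * r) : ℂ) = (1 - t : ℝ) - (r * t : ℝ) * Complex.I :=
    fun r ↦ by push_cast; ring
  have h2 : ∀ r : ℝ, (1 - t * (1 - Complex.I * r) : ℂ) = (1 - t : ℝ) + (r * t : ℝ) * Complex.I :=
    fun r ↦ by push_cast; ring
  simp only [lauricellaKernel, Fin.prod_univ_four, Pi.smul_apply, smul_eq_mul,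
    Matrix.cons_val, h1, h2]
  rw [cpow_neg_half_mul_conj (sub_pos.2 ht), mul_assoc, cpow_neg_half_mul_conj (sub_pos.2 ht),
    ← Complex.ofReal_mul, Real.sqrt_mul (by positivity), mul_pow, mul_pow, one_div_mul_one_div]

theorem mem_lauricellaDomain_conj_pairs {a b : ℝ} (ha : a ≠ 0) (hb : b ≠ 0) :
    ![1 + Complex.I * a, 1 - Complex.I * a, 1 + Complex.I * b, 1 - Complex.I * b] ∈
      lauricellaDomain 4 := by
  intro i
  rw [Complex.mem_slitPlane_iff]
  right
  fin_cases i <;> simpa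

theorem betaIntegral_half_half :
    Complex.betaIntegral (1 / 2) (1 - 1 / 2) = ((Real.pi * 1 : ℝ) : ℂ) := by
  rw [show (1 - 1 / 2 : ℂ) = 1 / 2 by norm_num,
    Complex.betaIntegral_eq_Gamma_mul_div _ _ (by norm_num) (by norm_num),
    show (1 / 2 + 1 / 2 : ℂ) = 1 by norm_num, Complex.Gamma_one, Complex.Gamma_one_half_eq,
    ← Complex.cpow_add _ _ (by exact_mod_cast Real.pi_ne_zero)]
  norm_num

theorem betaIntegral_half_threeHalves :
    Complex.betaIntegral (1 / 2) (2 - 1 / 2) = ((Real.pi * (1 / 2) : ℝ) : ℂ) := by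
  rw [show (2 - 1 / 2 : ℂ) = 1 / 2 + 1 by norm_num,
    Complex.betaIntegral_eq_Gamma_mul_div _ _ (by norm_num) (by norm_num),
    show (1 / 2 + (1 / 2 + 1) : ℂ) = 1 + 1 by norm_num, Complex.Gamma_add_one _ (by norm_num),
    Complex.Gamma_add_one _ (by norm_num), Complex.Gamma_one, Complex.Gamma_one_half_eq,
    mul_left_comm, ← Complex.cpow_add _ _ (by exact_mod_cast Real.pi_ne_zero)]
  norm_num
  ring

theorem betaIntegral_threeHalves_half :
    Complex.betaIntegral (3 / 2) (2 - 3 / 2) = ((Real.pi * (1 / 2) : ℝ) : ℂ) := by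
  rw [Complex.betaIntegral_symm, ← betaIntegral_half_threeHalves]
  norm_num

/-- Common last step of the six formulae: p is the Beta value over π and J the Euler integral, whose
positivity forces F ≠ 0. -/
theorem pi_eq_mul_div_of_beta_mul {B F : ℂ} {p c K J : ℝ} (hB : B = ((Real.pi * p : ℝ) : ℂ))
    (h : B * F = (J : ℂ)) (hJ : 0 < J) (hK : c * K * p = J) :
    (Real.pi : ℂ) = (c : ℂ) * ((K : ℂ) / F) := by
  have hF : F ≠ 0 := by
    rintro rfl
    rw [mul_zero] at h
    exact hJ.ne (by exact_mod_cast h)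
  have hp : (p : ℂ) ≠ 0 := by
    rintro h0
    rw [Complex.ofReal_eq_zero.1 h0, mul_zero] at hK
    exact hJ.ne hK
  rw [← mul_div_assoc, eq_div_iff hF]
  apply mul_right_cancel₀ hp
  rw [mul_right_comm, ← Complex.ofReal_mul, ← hB, h, ← hK]
  push_cast
  ring

theorem setIntegral_Ioo_one_sub (g : ℝ → ℝ) :
    ∫ t in Ioo (0 : ℝ) 1, g (1 - t) = ∫ t in Ioo (0 : ℝ) 1, g t := by
  simp only [← integral_Ioc_eq_integral_Ioo, ← intervalIntegral.integral_of_le zero_le_one]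
  simp

/-- Under t ↦ 1-t each factor 1 - tx becomes a constant times 1 - tx/(x-1); the constants combine
into the prefactor. -/
theorem reflected_genusTwo_integrand {a b t : ℝ} (hb : 0 < b) (hab : b < a)
    (ht : t ∈ Ioo (0 : ℝ) 1) :
    1 / √((1 - t * (1 / 2)) * (1 - t * (b / (a + b))) * (1 - t * (b / (b - a)))) =
      √(2 * ((a - b) * (a + b))) / a * (√(1 - t) * √t *
        (1 / √((1 - t) * (1 - (1 - t) ^ 2) * (1 - (b / a) ^ 2 * (1 - t) ^ 2)))) := by
  have ha : 0 < a := hb.trans hab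
  have hd : 0 < a - b := sub_pos.2 hab
  have ht0 := ht.1
  have ht1 : 0 < 1 - t := sub_pos.2 ht.2
  have h2 : 0 < 2 - t := by linarith
  have hp : 0 < a + b * (1 - t) := by positivity
  have hm : 0 < a - b * (1 - t) := by nlinarith
  have e1 : (1 - t * (1 / 2)) * (1 - t * (b / (a + b))) * (1 - t * (b / (b - a))) =
      (2 - t) * ((a + b * (1 - t)) * (a - b * (1 - t))) / (2 * ((a - b) * (a + b))) := by
    have : b - a ≠ 0 := by linarith
    have : a - b ≠ 0 := hd.ne'
    rw [show b / (b - a) = -(b / (a - b)) by rw [← neg_sub a b, div_neg]]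
    field_simp
    ring
  have e2 : (1 - t) * (1 - (1 - t) ^ 2) * (1 - (b / a) ^ 2 * (1 - t) ^ 2) =
      (1 - t) * t * ((2 - t) * ((a + b * (1 - t)) * (a - b * (1 - t)))) / a ^ 2 := by
    field_simp
    ring
  rw [e1, e2, Real.sqrt_div (by positivity), Real.sqrt_div (by positivity), Real.sqrt_sq ha.le,
    Real.sqrt_mul (by positivity) ((2 - t) * _), Real.sqrt_mul ht1.le]
  have h3 : 0 < √((2 - t) * ((a + b * (1 - t)) * (a - b * (1 - t)))) :=
    Real.sqrt_pos.2 (by positivity)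
  have h4 := Real.sqrt_pos.2 ht0
  have h5 := Real.sqrt_pos.2 ht1
  field_simp

theorem genusTwo_integrand {a b t : ℝ} (hb : 0 < b) (hab : b < a) (ht : t ∈ Ioo (0 : ℝ) 1) :
    1 / √((1 - t * -1) * (1 - t * (b / a)) * (1 - t * -(b / a))) =
      √t * √(1 - t) * (1 / √(t * (1 - t ^ 2) * (1 - (b / a) ^ 2 * t ^ 2))) ∧
    0 < t * (1 - t ^ 2) * (1 - (b / a) ^ 2 * t ^ 2) := by
  have ha : 0 < a := hb.trans hab
  have hk0 : 0 < b / a := div_pos hb ha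
  have hk1 : b / a < 1 := (div_lt_one ha).2 hab
  have ht0 := ht.1
  have ht1 : 0 < 1 - t := sub_pos.2 ht.2
  have hm : 0 < 1 - t * (b / a) := by nlinarith
  have e : t * (1 - t ^ 2) * (1 - (b / a) ^ 2 * t ^ 2) =
      t * (1 - t) * ((1 - t * -1) * (1 - t * (b / a)) * (1 - t * -(b / a))) := by ring
  have h1 : 0 < 1 - t * -1 := by linarith
  have h2 : 0 < 1 - t * -(b / a) := by nlinarith
  rw [e, Real.sqrt_mul (mul_pos ht0 ht1).le ((1 - t * -1) * _ * _), Real.sqrt_mul ht0.le]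
  have h3 : 0 < √((1 - t * -1) * (1 - t * (b / a)) * (1 - t * -(b / a))) :=
    Real.sqrt_pos.2 (by positivity)
  have h4 := Real.sqrt_pos.2 ht0
  have h5 := Real.sqrt_pos.2 ht1
  exact ⟨by field_simp, by positivity⟩

/-! ### Assembly of the six formulae -/

theorem theorem3p2 (a b : ℝ) (hb : 0 < b) (hab : b < a) :
    (Real.pi : ℂ) =
      ((4 / Real.sqrt (a * b * (a + b)) : ℝ) : ℂ) *
        ((ellipticKMinus a b : ℝ) /
          lauricellaFD (3 / 2) (fun _ : Fin 4 => 1 / 2) 2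
            ![1 + Complex.I * a, 1 - Complex.I * a, 1 + Complex.I * b, 1 - Complex.I * b]) ∧
    (Real.pi : ℂ) =
      ((4 / Real.sqrt (a + b) : ℝ) : ℂ) *
        ((ellipticKMinus a b : ℝ) /
          lauricellaFD (1 / 2) (fun _ : Fin 4 => 1 / 2) 2
            ![1 + Complex.I * a, 1 - Complex.I * a, 1 + Complex.I * b, 1 - Complex.I * b]) ∧
    (Real.pi : ℂ) =
      ((2 * Real.sqrt (a - b) / Real.sqrt b : ℝ) : ℂ) *
        ((ellipticKPlus a b - ellipticKMinus a b : ℝ) /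
          lauricellaFD (1 / 2) (fun _ : Fin 3 => 1 / 2) 2
            ![1 / 2, (b : ℂ) / (a + b), (b : ℂ) / (b - a)]) ∧
    (Real.pi : ℂ) =
      ((Real.sqrt (a - b) / Real.sqrt a : ℝ) : ℂ) *
        ((ellipticKPlus a b + ellipticKMinus a b : ℝ) /
          lauricellaFD (1 / 2) (fun _ : Fin 3 => 1 / 2) 1
            ![1 / 2, (b : ℂ) / (a + b), (b : ℂ) / (b - a)]) ∧
    (Real.pi : ℂ) =
      ((Real.sqrt a / Real.sqrt (2 * (a + b)) : ℝ) : ℂ) *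
        ((ellipticKPlus a b + ellipticKMinus a b : ℝ) /
          lauricellaFD (1 / 2) (fun _ : Fin 3 => 1 / 2) 1
            ![-1, (b : ℂ) / a, -((b : ℂ) / a)]) ∧
    (Real.pi : ℂ) =
      ((Real.sqrt 2 * a / Real.sqrt (b * (a + b)) : ℝ) : ℂ) *
        ((ellipticKPlus a b - ellipticKMinus a b : ℝ) /
          lauricellaFD (3 / 2) (fun _ : Fin 3 => 1 / 2) 2
            ![-1, (b : ℂ) / a, -((b : ℂ) / a)]) := by
  have ha : 0 < a := hb.trans hab
  have hd : 0 < a - b := sub_pos.2 hab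
  have hk1 : b / a < 1 := (div_lt_one ha).2 hab
  have hk0 : 0 < b / a := div_pos hb ha
  have r1 : (0 : ℝ) < (1 / 2 : ℂ).re := by norm_num
  have r2 : (0 : ℝ) < (3 / 2 : ℂ).re := by norm_num
  have r3 : (0 : ℝ) < (2 - 1 / 2 : ℂ).re := by norm_num
  have r4 : (0 : ℝ) < (2 - 3 / 2 : ℂ).re := by norm_num
  have r5 : (0 : ℝ) < (1 - 1 / 2 : ℂ).re := by norm_num
  have hP : ∀ t ∈ Ioo (0 : ℝ) 1,
      0 < √(((1 - t) ^ 2 + a ^ 2 * t ^ 2) * ((1 - t) ^ 2 + b ^ 2 * t ^ 2)) := fun t ht ↦ by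
    have := ht.1
    exact Real.sqrt_pos.2 (by positivity)
  have hs : ∀ t ∈ Ioo (0 : ℝ) 1, 0 < √t ∧ 0 < √(1 - t) := fun t ht ↦
    ⟨Real.sqrt_pos.2 ht.1, Real.sqrt_pos.2 (sub_pos.2 ht.2)⟩
  have hm4 := mem_lauricellaDomain_conj_pairs ha.ne' hb.ne'
  obtain ⟨hC, hC', hC0⟩ := lauricellaIntegral_eq_ofReal r2 r4 hm4
    (β := fun _ ↦ 1 / 2) (g := fun t ↦ √t / √(1 - t) /
      √(((1 - t) ^ 2 + a ^ 2 * t ^ 2) * ((1 - t) ^ 2 + b ^ 2 * t ^ 2)))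
    (fun t ht ↦ by
      rw [eulerWeight_threeHalves_two ht, lauricellaKernel_conj_pairs ht.2, ← Complex.ofReal_mul,
        mul_one_div])
    (fun t ht ↦ div_pos (div_pos (hs t ht).1 (hs t ht).2) (hP t ht))
  obtain ⟨hD, hD', hD0⟩ := lauricellaIntegral_eq_ofReal r1 r3 hm4
    (β := fun _ ↦ 1 / 2) (g := fun t ↦ √(1 - t) / √t /
      √(((1 - t) ^ 2 + a ^ 2 * t ^ 2) * ((1 - t) ^ 2 + b ^ 2 * t ^ 2)))
    (fun t ht ↦ by
      rw [eulerWeight_half_two ht, lauricellaKernel_conj_pairs ht.2, ← Complex.ofReal_mul,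
        mul_one_div])
    (fun t ht ↦ div_pos (div_pos (hs t ht).2 (hs t ht).1) (hP t ht))
  have hm3 := mem_lauricellaDomain_fin_three (x := -1) (y := b / a) (z := -(b / a))
    (by norm_num) hk1 (by linarith)
  have hker : ∀ t ∈ Ioo (0 : ℝ) 1, lauricellaKernel (fun _ : Fin 3 ↦ 1 / 2)
      ((t : ℂ) • ![((-1 : ℝ) : ℂ), ((b / a : ℝ) : ℂ), ((-(b / a) : ℝ) : ℂ)]) =
      (√t * √(1 - t) * (1 / √(t * (1 - t ^ 2) * (1 - (b / a) ^ 2 * t ^ 2))) : ℝ) := fun t ht ↦ by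
    have := ht.1
    have := ht.2
    rw [lauricellaKernel_fin_three (by linarith) (by nlinarith) (by nlinarith),
      (genusTwo_integrand hb hab ht).1]
  obtain ⟨hA, hA', hA0⟩ := lauricellaIntegral_eq_ofReal r1 r5 hm3
    (β := fun _ ↦ 1 / 2) (g := fun t ↦ 1 / √(t * (1 - t ^ 2) * (1 - (b / a) ^ 2 * t ^ 2)))
    (fun t ht ↦ by
      have h1 := (hs t ht).1
      have h2 := (hs t ht).2
      rw [eulerWeight_half_one ht, hker t ht, ← Complex.ofReal_mul]
      congr 1
      field_simp)
    (fun t ht ↦ one_div_pos.2 (Real.sqrt_pos.2 (genusTwo_integrand hb hab ht).2))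
  obtain ⟨hB, hB', hB0⟩ := lauricellaIntegral_eq_ofReal r2 r4 hm3
    (β := fun _ ↦ 1 / 2) (g := fun t ↦ t / √(t * (1 - t ^ 2) * (1 - (b / a) ^ 2 * t ^ 2)))
    (fun t ht ↦ by
      have h2 := (hs t ht).2
      rw [eulerWeight_threeHalves_two ht, hker t ht, ← Complex.ofReal_mul]
      congr 1
      rw [← mul_assoc, show √t / √(1 - t) * (√t * √(1 - t)) = √t * √t by field_simp,
        Real.mul_self_sqrt ht.1.le, mul_one_div])
    (fun t ht ↦ div_pos ht.1 (Real.sqrt_pos.2 (genusTwo_integrand hb hab ht).2))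
  have hm3' := mem_lauricellaDomain_fin_three (x := 1 / 2) (y := b / (a + b)) (z := b / (b - a))
    (by norm_num) ((div_lt_one (by positivity)).2 (by linarith))
    ((div_neg_of_pos_of_neg hb (by linarith)).trans one_pos)
  have hker' : ∀ t ∈ Ioo (0 : ℝ) 1, lauricellaKernel (fun _ : Fin 3 ↦ 1 / 2)
      ((t : ℂ) • ![((1 / 2 : ℝ) : ℂ), ((b / (a + b) : ℝ) : ℂ), ((b / (b - a) : ℝ) : ℂ)]) =
      (√(2 * ((a - b) * (a + b))) / a * (√(1 - t) * √t *
        (1 / √((1 - t) * (1 - (1 - t) ^ 2) * (1 - (b / a) ^ 2 * (1 - t) ^ 2)))) : ℝ) :=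
      fun t ht ↦ by
    have h1 := ht.1
    have h2 := ht.2
    have h3 : b / (a + b) < 1 := (div_lt_one (by positivity)).2 (by linarith)
    have h4 : b / (b - a) < 0 := div_neg_of_pos_of_neg hb (by linarith)
    have h5 : 0 < b / (a + b) := by positivity
    rw [lauricellaKernel_fin_three (by linarith) (by nlinarith) (by nlinarith),
      reflected_genusTwo_integrand hb hab ht]
  have hrefl : ∀ t ∈ Ioo (0 : ℝ) 1, 1 - t ∈ Ioo (0 : ℝ) 1 := fun t ht ↦
    ⟨sub_pos.2 ht.2, by linarith [ht.1]⟩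
  have hq : 0 < √(2 * ((a - b) * (a + b))) / a := div_pos (Real.sqrt_pos.2 (by positivity)) ha
  obtain ⟨-, hE', hE0⟩ := lauricellaIntegral_eq_ofReal r1 r5 hm3'
    (β := fun _ ↦ 1 / 2) (g := fun t ↦ √(2 * ((a - b) * (a + b))) / a *
      (1 / √((1 - t) * (1 - (1 - t) ^ 2) * (1 - (b / a) ^ 2 * (1 - t) ^ 2))))
    (fun t ht ↦ by
      have h1 := (hs t ht).1
      have h2 := (hs t ht).2
      rw [eulerWeight_half_one ht, hker' t ht, ← Complex.ofReal_mul]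
      congr 1
      field_simp)
    (fun t ht ↦ mul_pos hq
      (one_div_pos.2 (Real.sqrt_pos.2 (genusTwo_integrand hb hab (hrefl t ht)).2)))
  obtain ⟨-, hG', hG0⟩ := lauricellaIntegral_eq_ofReal r1 r3 hm3'
    (β := fun _ ↦ 1 / 2) (g := fun t ↦ √(2 * ((a - b) * (a + b))) / a *
      ((1 - t) / √((1 - t) * (1 - (1 - t) ^ 2) * (1 - (b / a) ^ 2 * (1 - t) ^ 2))))
    (fun t ht ↦ by
      have h1 := (hs t ht).1
      rw [eulerWeight_half_two ht, hker' t ht, ← Complex.ofReal_mul]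
      congr 1
      rw [mul_left_comm, ← mul_assoc (√(1 - t) / √t),
        show √(1 - t) / √t * (√(1 - t) * √t) = √(1 - t) * √(1 - t) by field_simp,
        Real.mul_self_sqrt (sub_pos.2 ht.2).le, mul_one_div])
    (fun t ht ↦ mul_pos hq (div_pos (hrefl t ht).1
      (Real.sqrt_pos.2 (genusTwo_integrand hb hab (hrefl t ht)).2)))
  -- Reflection identifies the integrals at 1/2, b/(a+b), b/(b-a) with multiples of the genus two
  -- integrals already treated.
  rw [integral_const_mul, setIntegral_Ioo_one_sub
    (fun t ↦ 1 / √(t * (1 - t ^ 2) * (1 - (b / a) ^ 2 * t ^ 2)))] at hE' hE0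
  rw [integral_const_mul, setIntegral_Ioo_one_sub
    (fun t ↦ t / √(t * (1 - t ^ 2) * (1 - (b / a) ^ 2 * t ^ 2)))] at hG' hG0
  have hDK := integral_quartic_eq_ellipticKMinus ha hb hC hD
  have hDC := integral_quartic_reflect (a := a) (b := b) (c := √(a * b))
    (Real.sqrt_pos.2 (by positivity)) (Real.sq_sqrt (by positivity))
  obtain ⟨hAK, hBK⟩ := integral_genusTwo_eq hb hab hA hB
  have sa : 0 < √a := Real.sqrt_pos.2 ha
  have sb : 0 < √b := Real.sqrt_pos.2 hb
  have sp : 0 < √(a + b) := Real.sqrt_pos.2 (by positivity)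
  have sm : 0 < √(a - b) := Real.sqrt_pos.2 hd
  have s2 : 0 < √2 := by positivity
  have q2 : √2 ^ 2 = 2 := Real.sq_sqrt (by norm_num)
  have qa : √a ^ 2 = a := Real.sq_sqrt ha.le
  have e2 : √(2 * (a + b)) = √2 * √(a + b) := Real.sqrt_mul (by norm_num) _
  have e3 : √(b * (a + b)) = √b * √(a + b) := Real.sqrt_mul hb.le _
  have e4 : √(2 * (b * (a + b))) = √2 * (√b * √(a + b)) := by
    rw [Real.sqrt_mul (by norm_num), e3]
  have e5 : √(2 * ((a - b) * (a + b))) = √2 * (√(a - b) * √(a + b)) := by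
    rw [Real.sqrt_mul (by norm_num), Real.sqrt_mul hd.le]
  have e6 : √(a * b * (a + b)) = √(a * b) * √(a + b) := Real.sqrt_mul (by positivity) _
  have v1 : ![(-1 : ℂ), (b : ℂ) / a, -((b : ℂ) / a)] =
      ![((-1 : ℝ) : ℂ), ((b / a : ℝ) : ℂ), ((-(b / a) : ℝ) : ℂ)] := by push_cast; rfl
  have v2 : ![(1 / 2 : ℂ), (b : ℂ) / (a + b), (b : ℂ) / (b - a)] =
      ![((1 / 2 : ℝ) : ℂ), ((b / (a + b) : ℝ) : ℂ), ((b / (b - a) : ℝ) : ℂ)] := by push_cast; rfl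
  rw [v1, v2]
  refine ⟨?_, ?_, ?_, ?_, ?_, ?_⟩
  · refine pi_eq_mul_div_of_beta_mul betaIntegral_threeHalves_half
      ((betaIntegral_mul_lauricellaFD _ r2 r4 hm4).trans hC') hC0 ?_
    have sc : 0 < √(a * b) := Real.sqrt_pos.2 (by positivity)
    -- Multiplying by √(ab) turns the α = 3/2 integral into the α = 1/2 one, whose value is known.
    apply mul_left_cancel₀ sc.ne'
    rw [← hDC, hDK, e6]
    field_simp
    ring
  · refine pi_eq_mul_div_of_beta_mul betaIntegral_half_threeHalves
      ((betaIntegral_mul_lauricellaFD _ r1 r3 hm4).trans hD') hD0 ?_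
    rw [hDK]
    ring
  · refine pi_eq_mul_div_of_beta_mul betaIntegral_half_threeHalves
      ((betaIntegral_mul_lauricellaFD _ r1 r3 hm3').trans hG') hG0 ?_
    rw [hBK, e4, e5]
    field_simp
  · refine pi_eq_mul_div_of_beta_mul betaIntegral_half_half
      ((betaIntegral_mul_lauricellaFD _ r1 r5 hm3').trans hE') hE0 ?_
    rw [hAK, e2, e5]
    field_simp
    rw [qa]
  · refine pi_eq_mul_div_of_beta_mul betaIntegral_half_half
      ((betaIntegral_mul_lauricellaFD _ r1 r5 hm3).trans hA') hA0 ?_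
    rw [hAK, mul_one]
  · refine pi_eq_mul_div_of_beta_mul betaIntegral_threeHalves_half
      ((betaIntegral_mul_lauricellaFD _ r2 r4 hm3).trans hB') hB0 ?_
    rw [hBK, e4, e3]
    field_simp
    rw [q2, mul_comm]
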